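/- Let $M$ be a smooth finite-dimensional real manifold (without boundary), let $\Omega^k(M)$ be the space of smooth $k$-forms on $M$, and let $\Omega(M)=\bigoplus_{k\ge 0}\Omega^k(M)$, with exterior derivative $d$ and wedge product. Put $[\alpha,\beta]=(-1)^a\,d(\alpha\wedge\beta)$ for $\alpha\in\Omega^a(M)$, extended bilinearly, and write $e_\psi(U)=\psi\wedge U$. A $\mathbb Z$-graded Lie superalgebra is a real vector space $\mathfrak g=\bigoplus_{i\in\mathbb Z}\mathfrak g_i$ with a bilinear bracket such that $[\mathfrak g_i,\mathfrak g_j]\subset\mathfrak g_{i+j}$ and, for $X\in\mathfrak g_x$, $Y\in\mathfrak g_y$, $Z\in\mathfrak g_z$, $[X,Y]+(-1)^{xy}[Y,X]=0$ and $(-1)^{xz}[[X,Y],Z]+(-1)^{yx}[[Y,Z],X]+(-1)^{zy}[[Z,X],Y]=0$. A coboundary operator of degree $q$ on $\mathfrak g$ is a linear map $\Phi:\mathfrak g\to\mathfrak g$ with $\Phi(\mathfrak g_i)\subset\mathfrak g_{i+q}$ for all $i$ and $\Phi\circ\Phi=0$; it defines the Poisson-like cohomology groups $H^{i,q}=\ker(\Phi:\mathfrak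 g_i\to\mathfrak g_{i+q})/\Phi(\mathfrak g_{i-q})$, $i\in\mathbb Z$. Give $\Omega(M)$ the grading in which a $k$-form has degree $k+1$. With this grading and the bracket above, $\Omega(M)$ is a $\mathbb Z$-graded Lie superalgebra. Let $p\ge 0$ be even, let $\varphi\in\Omega^p(M)$, and let $d_\varphi(U)=[\varphi,U]$ for $U\in\Omega(M)$. Then $[\varphi,\varphi]=d(\varphi\wedge\varphi)$, and the following hold. (1) If $d(\varphi\wedge\varphi)=0$, then $d_\varphi(U)=d(\varphi\wedge U)$ for all $U$, that is, $d_\varphi=d\circ e_\varphi=e_{d\varphi}+e_\varphi\circ d$, and $d_\varphi$ is a coboundary operator of degree $p+1$ (in particular $d_\varphi\circ d_\varphi=0$), so it defines Poisson-like cohomology groups. (2) If $d\varphi=0$, then $d_\varphi=e_\varphi\circ d$, and it is a coboundary operator of degree $p+1$, so it defines Poisson-like cohomology groups. In particular, for the constant function $\varphi=1$ the Poisson-like cohomology groups of $d_1$ are the de Rham cohomology groups of $M$: $H^{i,1}=0$ for $i\le 0$, and for every $k\ge 0$ the inclusion $\Omega^k(M)\subset\Omega(M)$ induces an isomorphism $H^k_{\mathrm{dR}}(M)\cong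 H^{k+1,1}$. -/

import Mathlib

open scoped Manifold ContDiff Topology DirectSum

noncomputable section

namespace FormCohomology

/-! ### Wedge product of alternating forms on a vector space -/

section Wedge

variable {V W : Type*} [AddCommGroup V] [Module ℝ V] [TopologicalSpace V]
  [AddCommGroup W] [Module ℝ W] [TopologicalSpace W] {p q : ℕ}

/-- The multilinear form `(v₁, …, v_{p+q}) ↦ a (v₁, …, v_p) * b (v_{p+1}, …, v_{p+q})`. -/
def tensor (a : V [⋀^Fin p]→L[ℝ] ℝ) (b : V [⋀^Fin q]→L[ℝ] ℝ) :
    ContinuousMultilinearMap ℝ (fun _ : Fin (p + q) => V) ℝ where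
  toMultilinearMap :=
    ((LinearMap.mul' ℝ ℝ).compMultilinearMap
      (MultilinearMap.domCoprod a.toMultilinearMap b.toMultilinearMap)).domDomCongr finSumFinEquiv
  cont := by
    change Continuous fun v : Fin (p + q) → V =>
      a (fun i => v (finSumFinEquiv (Sum.inl i))) * b (fun j => v (finSumFinEquiv (Sum.inr j)))
    exact (a.cont.comp (continuous_pi fun i => continuous_apply _)).mul
      (b.cont.comp (continuous_pi fun i => continuous_apply _))

theorem tensor_apply (a : V [⋀^Fin p]→L[ℝ] ℝ) (b : V [⋀^Fin q]→L[ℝ] ℝ) (v : Fin (p + q) → V) :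
    tensor a b v = a (fun i => v (Fin.castAdd q i)) * b (fun j => v (Fin.natAdd p j)) := rfl

/-- The wedge product
`(a ∧ b)(v₁, …, v_{p+q}) = (1 / (p! q!)) ∑_σ sign σ · a (v_{σ 1}, …) * b (v_{σ (p+1)}, …)`. -/
def wedge (a : V [⋀^Fin p]→L[ℝ] ℝ) (b : V [⋀^Fin q]→L[ℝ] ℝ) : V [⋀^Fin (p + q)]→L[ℝ] ℝ :=
  ((p.factorial : ℝ) * (q.factorial : ℝ))⁻¹ •
    ContinuousMultilinearMap.alternatization (tensor a b)

theorem wedge_apply (a : V [⋀^Fin p]→L[ℝ] ℝ) (b : V [⋀^Fin q]→L[ℝ] ℝ) (v : Fin (p + q) → V) :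
    wedge a b v = ((p.factorial : ℝ) * (q.factorial : ℝ))⁻¹ *
      ∑ σ : Equiv.Perm (Fin (p + q)), ((Equiv.Perm.sign σ : ℤ) : ℝ) *
        (a (fun i => v (σ (Fin.castAdd q i))) * b (fun j => v (σ (Fin.natAdd p j)))) := by
  simp only [wedge, ContinuousAlternatingMap.smul_apply,
    ContinuousMultilinearMap.alternatization_apply_apply, tensor_apply, smul_eq_mul,
    Function.comp_apply, Units.smul_def, zsmul_eq_mul]

theorem wedge_add_left (a a' : V [⋀^Fin p]→L[ℝ] ℝ) (b : V [⋀^Fin q]→L[ℝ] ℝ) :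
    wedge (a + a') b = wedge a b + wedge a' b := by
  ext v
  simp only [wedge_apply, ContinuousAlternatingMap.add_apply, add_mul, mul_add,
    Finset.sum_add_distrib]

theorem wedge_add_right (a : V [⋀^Fin p]→L[ℝ] ℝ) (b b' : V [⋀^Fin q]→L[ℝ] ℝ) :
    wedge a (b + b') = wedge a b + wedge a b' := by
  ext v
  simp only [wedge_apply, ContinuousAlternatingMap.add_apply, mul_add, Finset.sum_add_distrib]

theorem wedge_smul_left (c : ℝ) (a : V [⋀^Fin p]→L[ℝ] ℝ) (b : V [⋀^Fin q]→L[ℝ] ℝ) :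
    wedge (c • a) b = c • wedge a b := by
  ext v
  simp only [wedge_apply, ContinuousAlternatingMap.smul_apply, smul_eq_mul, Finset.mul_sum]
  exact Finset.sum_congr rfl fun σ _ => by ring

theorem wedge_smul_right (c : ℝ) (a : V [⋀^Fin p]→L[ℝ] ℝ) (b : V [⋀^Fin q]→L[ℝ] ℝ) :
    wedge a (c • b) = c • wedge a b := by
  ext v
  simp only [wedge_apply, ContinuousAlternatingMap.smul_apply, smul_eq_mul, Finset.mul_sum]
  exact Finset.sum_congr rfl fun σ _ => by ring

theorem wedge_compContinuousLinearMap (a : V [⋀^Fin p]→L[ℝ] ℝ) (b : V [⋀^Fin q]→L[ℝ] ℝ)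
    (f : W →L[ℝ] V) :
    (wedge a b).compContinuousLinearMap f =
      wedge (a.compContinuousLinearMap f) (b.compContinuousLinearMap f) := by
  ext v
  simp only [wedge_apply, ContinuousAlternatingMap.compContinuousLinearMap_apply,
    Function.comp_def]

end Wedge

section WedgeSmooth

variable {E : Type*} [NormedAddCommGroup E] [NormedSpace ℝ E] {p q : ℕ}

theorem norm_wedge_le (a : E [⋀^Fin p]→L[ℝ] ℝ) (b : E [⋀^Fin q]→L[ℝ] ℝ) :
    ‖wedge a b‖ ≤ (((p.factorial : ℝ) * (q.factorial : ℝ))⁻¹ * ((p + q).factorial : ℝ)) *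
      ‖a‖ * ‖b‖ := by
  refine ContinuousAlternatingMap.opNorm_le_bound _ (by positivity) fun v => ?_
  rw [wedge_apply, norm_mul, Real.norm_of_nonneg (by positivity), mul_assoc, mul_assoc, mul_assoc]
  refine mul_le_mul_of_nonneg_left ?_ (by positivity)
  refine (norm_sum_le _ _).trans ?_
  have hb : ∀ σ ∈ (Finset.univ : Finset (Equiv.Perm (Fin (p + q)))),
      ‖((Equiv.Perm.sign σ : ℤ) : ℝ) *
        (a (fun i => v (σ (Fin.castAdd q i))) * b (fun j => v (σ (Fin.natAdd p j))))‖ ≤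
      ‖a‖ * (‖b‖ * ∏ i, ‖v i‖) := by
    intro σ _
    have h1 : ‖((Equiv.Perm.sign σ : ℤ) : ℝ)‖ = 1 := by
      rcases Int.units_eq_one_or (Equiv.Perm.sign σ) with h | h <;> simp [h]
    have h2 : ∏ i, ‖v i‖ = (∏ i, ‖v (σ (Fin.castAdd q i))‖) * ∏ j, ‖v (σ (Fin.natAdd p j))‖ := by
      rw [← Equiv.prod_comp σ, Fin.prod_univ_add]
    rw [norm_mul, h1, one_mul, norm_mul, h2]
    calc _ ≤ (‖a‖ * ∏ i, ‖v (σ (Fin.castAdd q i))‖) * (‖b‖ * ∏ j, ‖v (σ (Fin.natAdd p j))‖) :=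
          mul_le_mul (a.le_opNorm _) (b.le_opNorm _) (norm_nonneg _) (by positivity)
      _ = _ := by ring
  refine (Finset.sum_le_sum hb).trans (le_of_eq ?_)
  simp [Fintype.card_perm]

theorem isBoundedBilinearMap_wedge :
    IsBoundedBilinearMap ℝ fun ab : (E [⋀^Fin p]→L[ℝ] ℝ) × (E [⋀^Fin q]→L[ℝ] ℝ) =>
      wedge ab.1 ab.2 where
  add_left := wedge_add_left
  smul_left := wedge_smul_left
  add_right := wedge_add_right
  smul_right := wedge_smul_right
  bound := ⟨((p.factorial : ℝ) * (q.factorial : ℝ))⁻¹ * ((p + q).factorial : ℝ), by positivity,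
    norm_wedge_le⟩

theorem contDiff_wedge : ContDiff ℝ ∞
    fun ab : (E [⋀^Fin p]→L[ℝ] ℝ) × (E [⋀^Fin q]→L[ℝ] ℝ) => wedge ab.1 ab.2 := by
  have h := isBoundedBilinearMap_wedge (E := E) (p := p) (q := q)
  exact h.contDiff

theorem contDiffOn_wedge {α : E → E [⋀^Fin p]→L[ℝ] ℝ} {β : E → E [⋀^Fin q]→L[ℝ] ℝ} {s : Set E}
    (hα : ContDiffOn ℝ ∞ α s) (hβ : ContDiffOn ℝ ∞ β s) :
    ContDiffOn ℝ ∞ (fun y => wedge (α y) (β y)) s := by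
  have h1 := hα.prodMk hβ
  have h2 := (contDiff_wedge (E := E) (p := p) (q := q)).comp_contDiffOn h1
  exact h2

theorem contDiffOn_extDeriv {α : E → E [⋀^Fin p]→L[ℝ] ℝ} {s : Set E} (hs : IsOpen s)
    (hα : ContDiffOn ℝ ∞ α s) : ContDiffOn ℝ ∞ (extDeriv α) s :=
  (ContinuousAlternatingMap.alternatizeUncurryFinCLM ℝ E ℝ).contDiff.comp_contDiffOn
    (hα.fderiv_of_isOpen hs (by simp))

end WedgeSmooth

/-! ### Differential forms on a manifold -/

section Forms

variable (E : Type*) [NormedAddCommGroup E] [NormedSpace ℝ E]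
  (M : Type*) [TopologicalSpace M] [ChartedSpace E M]

/-- A (not necessarily smooth) field of alternating `k`-forms on the tangent spaces of `M`. -/
abbrev FormField (k : ℕ) : Type _ := ∀ x : M, TangentSpace 𝓘(ℝ, E) x [⋀^Fin k]→L[ℝ] ℝ

variable {E M}

/-- The coordinate expression of `w` in the chart `e`: the pullback of `w` along `e.symm`. -/
def coordRep {k : ℕ} (w : FormField E M k) (e : OpenPartialHomeomorph M E) (y : E) :
    E [⋀^Fin k]→L[ℝ] ℝ :=
  (w (e.symm y)).compContinuousLinearMap (mfderiv 𝓘(ℝ, E) 𝓘(ℝ, E) e.symm y)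

theorem coordRep_add {k : ℕ} (w u : FormField E M k) (e : OpenPartialHomeomorph M E) :
    coordRep (w + u) e = coordRep w e + coordRep u e := rfl

theorem coordRep_smul {k : ℕ} (c : ℝ) (w : FormField E M k) (e : OpenPartialHomeomorph M E) :
    coordRep (c • w) e = c • coordRep w e := rfl

theorem coordRep_wedge {p q : ℕ} (w : FormField E M p) (u : FormField E M q)
    (e : OpenPartialHomeomorph M E) (y : E) :
    coordRep (fun x => wedge (w x) (u x)) e y = wedge (coordRep w e y) (coordRep u e y) :=
  wedge_compContinuousLinearMap _ _ _

variable (E M) in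
/-- The submodule of smooth `k`-forms: the fields of alternating `k`-forms whose coordinate
expression in every chart of the atlas is smooth. -/
def smoothForms (k : ℕ) : Submodule ℝ (FormField E M k) where
  carrier := {w | ∀ e ∈ atlas E M, ContDiffOn ℝ ∞ (coordRep w e) e.target}
  add_mem' ha hb e he := (ha e he).add (hb e he)
  zero_mem' _ _ := contDiffOn_const (c := 0)
  smul_mem' c _ ha e he := (ha e he).const_smul c

variable (E M) in
/-- The space `Ω^k(M)` of smooth `k`-forms on `M`. -/
def Form (k : ℕ) : Type _ := smoothForms E M k

instance (k : ℕ) : AddCommGroup (Form E M k) := inferInstanceAs (AddCommGroup (smoothForms E M k))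

instance (k : ℕ) : Module ℝ (Form E M k) := inferInstanceAs (Module ℝ (smoothForms E M k))

/-- The wedge product of smooth forms. -/
def Form.wedge {p q : ℕ} (α : Form E M p) (β : Form E M q) : Form E M (p + q) :=
  ⟨fun x => FormCohomology.wedge (α.1 x) (β.1 x), fun e he =>
    (contDiffOn_wedge (α.2 e he) (β.2 e he)).congr fun y _ => coordRep_wedge α.1 β.1 e y⟩

/-- The constant function `1`, as a `0`-form. -/
def Form.one : Form E M 0 :=
  ⟨fun _ => ContinuousAlternatingMap.constOfIsEmpty ℝ _ (Fin 0) 1, fun _ _ =>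
    contDiffOn_const (c := ContinuousAlternatingMap.constOfIsEmpty ℝ E (Fin 0) (1 : ℝ))⟩

theorem Form.differentiableAt {k : ℕ} (w : Form E M k) (x : M) :
    DifferentiableAt ℝ (coordRep w.1 (chartAt E x)) (chartAt E x x) :=
  ((w.2 _ (chart_mem_atlas E x)).contDiffAt ((chartAt E x).open_target.mem_nhds
    (mem_chart_target E x))).differentiableAt (by simp)

/-- The exterior derivative of a field of forms, computed at `x` in the preferred chart at `x`. -/
def extDerivField {k : ℕ} (w : FormField E M k) : FormField E M (k + 1) := fun x =>
  (extDeriv (coordRep w (chartAt E x)) (chartAt E x x)).compContinuousLinearMap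
    (mfderiv 𝓘(ℝ, E) 𝓘(ℝ, E) (chartAt E x) x)

section ExtDeriv

variable {E : Type*} [NormedAddCommGroup E] [NormedSpace ℝ E]
  {M : Type*} [TopologicalSpace M] [ChartedSpace E M] [IsManifold 𝓘(ℝ, E) ∞ M]

theorem contDiffOn_transition {e e' : OpenPartialHomeomorph M E} (he : e ∈ atlas E M)
    (he' : e' ∈ atlas E M) : ContDiffOn ℝ ∞ (e' ∘ e.symm) (e.symm ≫ₕ e').source := by
  simpa [ModelWithCorners.extendCoordChange, mfld_simps, Function.comp_def] using
    𝓘(ℝ, E).contDiffOn_extendCoordChange (n := ∞)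
      (IsManifold.subset_maximalAtlas he) (IsManifold.subset_maximalAtlas he')

theorem mfderiv_symm_eq {e e' : OpenPartialHomeomorph M E} (he : e ∈ atlas E M)
    (he' : e' ∈ atlas E M) {y : E} (hy : y ∈ (e.symm ≫ₕ e').source) :
    (mfderiv 𝓘(ℝ, E) 𝓘(ℝ, E) e.symm y : E →L[ℝ] E) =
      (mfderiv 𝓘(ℝ, E) 𝓘(ℝ, E) e'.symm (e' (e.symm y)) : E →L[ℝ] E).comp
        (fderiv ℝ (e' ∘ e.symm) y) := by
  have hn : (1 : WithTop ℕ∞) ≤ ∞ := by simp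
  have : IsManifold 𝓘(ℝ, E) 1 M := IsManifold.of_le hn
  have hs := hy
  rw [OpenPartialHomeomorph.trans_source] at hs
  have hev : e.symm =ᶠ[𝓝 y] e'.symm ∘ (e' ∘ e.symm) := by
    filter_upwards [(e.symm ≫ₕ e').open_source.mem_nhds hy] with z hz
    rw [OpenPartialHomeomorph.trans_source] at hz
    exact (e'.left_inv hz.2).symm
  have hd : MDifferentiableAt 𝓘(ℝ, E) 𝓘(ℝ, E) (e' ∘ e.symm) y :=
    (mdifferentiableAt_atlas he' hs.2).comp y (mdifferentiableAt_atlas_symm he hs.1)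
  have hd' : MDifferentiableAt 𝓘(ℝ, E) 𝓘(ℝ, E) e'.symm ((e' ∘ e.symm) y) :=
    mdifferentiableAt_atlas_symm he' (e'.map_source hs.2)
  rw [hev.mfderiv_eq]
  exact (mfderiv_comp y hd' hd).trans (by rw [mfderiv_eq_fderiv]; rfl)

/-- Change of charts for coordinate expressions. -/
theorem coordRep_eq_pullback {k : ℕ} (w : FormField E M k) {e e' : OpenPartialHomeomorph M E}
    (he : e ∈ atlas E M) (he' : e' ∈ atlas E M) {y : E} (hy : y ∈ (e.symm ≫ₕ e').source) :
    coordRep w e y = (coordRep w e' ((e' ∘ e.symm) y)).compContinuousLinearMap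
      (fderiv ℝ (e' ∘ e.symm) y) := by
  have hs := hy
  rw [OpenPartialHomeomorph.trans_source] at hs
  have aux : ∀ (x : M) (L : E →L[ℝ] E), x = e.symm y →
      L = mfderiv 𝓘(ℝ, E) 𝓘(ℝ, E) e.symm y →
      coordRep w e y = ContinuousAlternatingMap.compContinuousLinearMap (w x) L := by
    rintro x L rfl rfl
    rfl
  exact aux _ _ (e'.left_inv hs.2) (mfderiv_symm_eq he he' hy).symm

/-- The exterior derivative is computed by `extDeriv` in every chart. -/
theorem coordRep_extDerivField {k : ℕ} (w : Form E M k) {e : OpenPartialHomeomorph M E}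
    (he : e ∈ atlas E M) {y : E} (hy : y ∈ e.target) :
    coordRep (extDerivField w.1) e y = extDeriv (coordRep w.1 e) y := by
  have hn : (1 : WithTop ℕ∞) ≤ ∞ := by simp
  have : IsManifold 𝓘(ℝ, E) 1 M := IsManifold.of_le hn
  set x := e.symm y with hx
  set e' := chartAt E x with he'def
  have he' : e' ∈ atlas E M := chart_mem_atlas E x
  have hxs : x ∈ e'.source := mem_chart_source E x
  have hys : y ∈ (e.symm ≫ₕ e').source := by
    rw [OpenPartialHomeomorph.trans_source]
    exact ⟨hy, hxs⟩
  have hev : coordRep w.1 e =ᶠ[𝓝 y] fun z => (coordRep w.1 e' ((e' ∘ e.symm) z)).compContinuousLinearMap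
      (fderiv ℝ (e' ∘ e.symm) z) := by
    filter_upwards [(e.symm ≫ₕ e').open_source.mem_nhds hys] with z hz
    exact coordRep_eq_pullback w.1 he he' hz
  have hτ : ContDiffAt ℝ ∞ (e' ∘ e.symm) y :=
    (contDiffOn_transition he he').contDiffAt ((e.symm ≫ₕ e').open_source.mem_nhds hys)
  have hw : DifferentiableAt ℝ (coordRep w.1 e') ((e' ∘ e.symm) y) :=
    ((w.2 e' he').contDiffAt (e'.open_target.mem_nhds (e'.map_source hxs))).differentiableAt
      (by simp)
  rw [hev.extDeriv_eq, extDeriv_pullback hw hτ (by rw [minSmoothness_of_isRCLikeNormedField]; exact WithTop.coe_le_coe.2 le_top)]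
  have hcomp : fderiv ℝ (e' ∘ e.symm) y = (mfderiv 𝓘(ℝ, E) 𝓘(ℝ, E) e' x : E →L[ℝ] E).comp
      (mfderiv 𝓘(ℝ, E) 𝓘(ℝ, E) e.symm y : E →L[ℝ] E) := by
    rw [← mfderiv_eq_fderiv]
    exact mfderiv_comp y (mdifferentiableAt_atlas he' hxs) (mdifferentiableAt_atlas_symm he hy)
  rw [hcomp]
  rfl

variable (E M) in
/-- The exterior derivative `d : Ω^k(M) → Ω^{k+1}(M)`. -/
def Form.d (k : ℕ) : Form E M k →ₗ[ℝ] Form E M (k + 1) where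
  toFun w := ⟨extDerivField w.1, fun e he =>
    (contDiffOn_extDeriv e.open_target (w.2 e he)).congr fun _ hy => coordRep_extDerivField w he hy⟩
  map_add' a b := by
    refine Subtype.ext (funext fun x => ?_)
    change ContinuousAlternatingMap.compContinuousLinearMap (extDeriv (coordRep a.1 (chartAt E x) +
      coordRep b.1 (chartAt E x)) (chartAt E x x)) _ = _
    rw [extDeriv_add (a.differentiableAt x) (b.differentiableAt x)]
    rfl
  map_smul' c a := by
    refine Subtype.ext (funext fun x => ?_)
    change ContinuousAlternatingMap.compContinuousLinearMap
      (extDeriv (c • coordRep a.1 (chartAt E x)) (chartAt E x x)) _ = _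
    rw [extDeriv_smul]
    rfl

end ExtDeriv

end Forms

/-! ### Graded Lie superalgebras and Poisson-like cohomology -/

section Superalgebra

variable {V : Type*} [AddCommGroup V] [Module ℝ V]

/-- The bilinear operation `br` makes the real vector space `V = ⨁_i 𝒢 i` a `ℤ`-graded
Lie superalgebra. -/
structure IsLieSuperalgebra (𝒢 : ℤ → Submodule ℝ V) (br : V →ₗ[ℝ] V →ₗ[ℝ] V) : Prop where
  isInternal : DirectSum.IsInternal 𝒢
  bracket_mem : ∀ i j : ℤ, ∀ x ∈ 𝒢 i, ∀ y ∈ 𝒢 j, br x y ∈ 𝒢 (i + j)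
  skew : ∀ i j : ℤ, ∀ x ∈ 𝒢 i, ∀ y ∈ 𝒢 j, br x y + (-1 : ℝ) ^ (i * j) • br y x = 0
  jacobi : ∀ i j k : ℤ, ∀ x ∈ 𝒢 i, ∀ y ∈ 𝒢 j, ∀ z ∈ 𝒢 k,
    (-1 : ℝ) ^ (i * k) • br (br x y) z + (-1 : ℝ) ^ (j * i) • br (br y z) x +
      (-1 : ℝ) ^ (k * j) • br (br z x) y = 0

/-- `Φ` is a coboundary operator of degree `p` on the graded vector space `V = ⨁_i 𝒢 i`. -/
structure IsCoboundaryOperator (𝒢 : ℤ → Submodule ℝ V) (p : ℤ) (Φ : V →ₗ[ℝ] V) : Prop where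
  map_mem : ∀ i : ℤ, ∀ x ∈ 𝒢 i, Φ x ∈ 𝒢 (i + p)
  comp_self : Φ ∘ₗ Φ = 0

/-- The kernel of `Φ` on `𝒢 i`. -/
def cocycles (𝒢 : ℤ → Submodule ℝ V) (Φ : V →ₗ[ℝ] V) (i : ℤ) : Submodule ℝ V :=
  𝒢 i ⊓ LinearMap.ker Φ

/-- The image `Φ (𝒢 (i - p))`. -/
def coboundaries (𝒢 : ℤ → Submodule ℝ V) (p : ℤ) (Φ : V →ₗ[ℝ] V) (i : ℤ) : Submodule ℝ V :=
  (𝒢 (i - p)).map Φ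

theorem IsCoboundaryOperator.coboundaries_le {𝒢 : ℤ → Submodule ℝ V} {p : ℤ} {Φ : V →ₗ[ℝ] V}
    (h : IsCoboundaryOperator 𝒢 p Φ) (i : ℤ) : coboundaries 𝒢 p Φ i ≤ cocycles 𝒢 Φ i := by
  rintro _ ⟨x, hx, rfl⟩
  refine ⟨?_, LinearMap.congr_fun h.comp_self x⟩
  have h1 := h.map_mem (i - p) x hx
  rwa [sub_add_cancel] at h1

/-- The Poisson-like cohomology `ker (Φ : 𝒢 i → 𝒢 (i + p)) / Φ (𝒢 (i - p))` of a coboundary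
operator `Φ` of degree `p`. -/
abbrev PoissonLikeCohomology {𝒢 : ℤ → Submodule ℝ V} {p : ℤ} {Φ : V →ₗ[ℝ] V}
    (_h : IsCoboundaryOperator 𝒢 p Φ) (i : ℤ) : Type _ :=
  cocycles 𝒢 Φ i ⧸ (coboundaries 𝒢 p Φ i).submoduleOf (cocycles 𝒢 Φ i)

end Superalgebra

/-! ### The superalgebra of differential forms -/

section TotalForms

variable (E : Type*) [NormedAddCommGroup E] [NormedSpace ℝ E]
  (M : Type*) [TopologicalSpace M] [ChartedSpace E M]

/-- The space `⨁_k Ω^k(M)` of all smooth forms. -/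
abbrev TotalForm : Type _ := ⨁ k : ℕ, Form E M k


/-- The inclusion `Ω^k(M) → ⨁_k Ω^k(M)`. -/
def inclForm (k : ℕ) : Form E M k →ₗ[ℝ] TotalForm E M :=
  DirectSum.lof ℝ ℕ (fun k => Form E M k) k

/-- The grading in which a `k`-form has degree `k + 1`. -/
def formGrading (i : ℤ) : Submodule ℝ (TotalForm E M) :=
  ⨆ (k : ℕ) (_ : (k : ℤ) + 1 = i), LinearMap.range (inclForm E M k)

/-- The wedge product of homogeneous forms as a bilinear map. -/
def wedgeBilin (p q : ℕ) : Form E M p →ₗ[ℝ] Form E M q →ₗ[ℝ] Form E M (p + q) :=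
  LinearMap.mk₂ ℝ (Form.wedge (E := E) (M := M) (p := p) (q := q))
    (fun _ _ _ => Subtype.ext (funext fun _ => wedge_add_left _ _ _))
    (fun _ _ _ => Subtype.ext (funext fun _ => wedge_smul_left _ _ _))
    (fun _ _ _ => Subtype.ext (funext fun _ => wedge_add_right _ _ _))
    (fun _ _ _ => Subtype.ext (funext fun _ => wedge_smul_right _ _ _))

/-- The wedge product on `⨁_k Ω^k(M)`; thus `totalWedge E M ψ` is the operator `e_ψ`. -/
def totalWedge : TotalForm E M →ₗ[ℝ] TotalForm E M →ₗ[ℝ] TotalForm E M :=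
  DirectSum.toModule ℝ ℕ (TotalForm E M →ₗ[ℝ] TotalForm E M) fun p =>
    (DirectSum.toModule ℝ ℕ (Form E M p →ₗ[ℝ] TotalForm E M) fun q =>
      ((wedgeBilin E M p q).compr₂ (inclForm E M (p + q))).flip).flip

/-- The operator `α ↦ (-1)^a α` for `a`-forms `α`. -/
def degreeSign : TotalForm E M →ₗ[ℝ] TotalForm E M :=
  DirectSum.toModule ℝ ℕ (TotalForm E M) fun a => (-1 : ℝ) ^ a • inclForm E M a

theorem totalWedge_incl {p q : ℕ} (α : Form E M p) (β : Form E M q) :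
    totalWedge E M (inclForm E M p α) (inclForm E M q β) = inclForm E M (p + q) (α.wedge β) := by
  simp only [totalWedge, inclForm, DirectSum.toModule_lof, LinearMap.flip_apply,
    LinearMap.compr₂_apply]
  rfl

variable [IsManifold 𝓘(ℝ, E) ∞ M]

/-- The exterior derivative on `⨁_k Ω^k(M)`. -/
def totalD : TotalForm E M →ₗ[ℝ] TotalForm E M :=
  DirectSum.toModule ℝ ℕ (TotalForm E M) fun k => inclForm E M (k + 1) ∘ₗ Form.d E M k

/-- The bracket `[α, β] = (-1)^a d (α ∧ β)` for `a`-forms `α`. -/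
def superBracket : TotalForm E M →ₗ[ℝ] TotalForm E M →ₗ[ℝ] TotalForm E M :=
  (totalWedge E M ∘ₗ degreeSign E M).compr₂ (totalD E M)

theorem totalD_incl {k : ℕ} (α : Form E M k) :
    totalD E M (inclForm E M k α) = inclForm E M (k + 1) (Form.d E M k α) := by
  simp [totalD, inclForm]

theorem superBracket_incl {a b : ℕ} (α : Form E M a) (β : Form E M b) :
    superBracket E M (inclForm E M a α) (inclForm E M b β) =
      (-1 : ℝ) ^ a • inclForm E M (a + b + 1) (Form.d E M (a + b) (α.wedge β)) := by
  have h : degreeSign E M (inclForm E M a α) = (-1 : ℝ) ^ a • inclForm E M a α := by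
    simp [degreeSign, inclForm]
  simp [superBracket, h, totalWedge_incl, totalD_incl]

/-- The operator `d_φ = [φ, ·]`. -/
def poissonD {p : ℕ} (φ : Form E M p) : TotalForm E M →ₗ[ℝ] TotalForm E M :=
  superBracket E M (inclForm E M p φ)

/-- The closed `k`-forms. -/
def closedForms (k : ℕ) : Submodule ℝ (Form E M k) := LinearMap.ker (Form.d E M k)

/-- The exact `k`-forms; only `0` is exact in degree `0`. -/
def exactForms : (k : ℕ) → Submodule ℝ (Form E M k)
  | 0 => ⊥
  | k + 1 => LinearMap.range (Form.d E M k)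

/-- The de Rham cohomology `H^k(M)`. -/
abbrev DeRhamCohomology (k : ℕ) : Type _ :=
  closedForms E M k ⧸ (exactForms E M k).submoduleOf (closedForms E M k)

end TotalForms

end FormCohomology

end

open scoped Manifold ContDiff Topology DirectSum

noncomputable section

/-! The theorem rests on three facts about `Ω(M)`: the wedge product is associative and graded
commutative, `d` satisfies the graded Leibniz rule, and `d ∘ d = 0`. They give `[[α, β], γ] = (-1)^a
d(α ∧ β) ∧ dγ`, a signed combination of two of the three forms `α ∧ dβ ∧ dγ`, `β ∧ dγ ∧ dα`, `γ ∧ dα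
∧ dβ`, and the six terms of the Jacobi sum cancel in pairs (`superBracket_jacobi_incl`).

For `φ` of even degree, `d(φ ∧ φ) = 2 φ ∧ dφ`. If this vanishes, then `φ ∧ dφ = 0`, hence `dφ ∧ dφ =
d(φ ∧ dφ) = 0`, and `d_φ (d_φ U) = dφ ∧ dφ ∧ U + dφ ∧ φ ∧ dU = 0` (`isCoboundaryOperator_poissonD`).
A closed `φ` is a special case. For `φ = 1` the operator is `d` itself, and the shift of degree by
one matches closed and exact `k`-forms with cocycles and coboundaries of degree `k + 1`.

Most of the work is pointwise algebra. The wedge product is a normalised signed sum over all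
permutations, and a further signed sum over some family of permutations, placed inside the full one,
only multiplies it by the size of the family (`altSum_absorb`). This principle yields both
associativity and the Leibniz rule. Since forms of degrees `p + q` and `q + p` have different types,
the pointwise identities carry `Fin.cast`; `inclForm_eq_smul` removes the casts by passing to the
direct sum. -/

namespace FormCohomology

/-! ### Signed sums over permutations. -/

section AltSum

variable {ι κ V : Type*} [Fintype ι] [DecidableEq ι] [Fintype κ] [DecidableEq κ]

/-- The signed sum of a function of `ι`-tuples over all permutations of its arguments. -/
def altSum (T : (ι → V) → ℝ) (v : ι → V) : ℝ :=
  ∑ σ : Equiv.Perm ι, ((Equiv.Perm.sign σ : ℤ) : ℝ) * T (v ∘ σ)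

theorem sign_mul_self (σ : Equiv.Perm ι) :
    ((Equiv.Perm.sign σ : ℤ) : ℝ) * ((Equiv.Perm.sign σ : ℤ) : ℝ) = 1 := by
  rcases Int.units_eq_one_or (Equiv.Perm.sign σ) with h | h <;> simp [h]

/-- Right translation by `π` reindexes the sum and changes every sign by `sign π`. -/
theorem altSum_comp_perm (T : (ι → V) → ℝ) (π : Equiv.Perm ι) (v : ι → V) :
    altSum (fun w => T (w ∘ π)) v = ((Equiv.Perm.sign π : ℤ) : ℝ) * altSum T v := by
  simp only [altSum]
  rw [← Equiv.sum_comp (Equiv.mulRight π) fun σ => ((Equiv.Perm.sign σ : ℤ) : ℝ) * T (v ∘ σ),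
    Finset.mul_sum]
  refine Finset.sum_congr rfl fun σ _ => ?_
  simp only [Equiv.coe_mulRight, Equiv.Perm.sign_mul, Units.val_mul, Int.cast_mul,
    Equiv.Perm.coe_mul, ← Function.comp_assoc]
  linear_combination (-((Equiv.Perm.sign σ : ℤ) : ℝ) * T ((v ∘ σ) ∘ π)) * sign_mul_self π

/-- Conjugation by `e` preserves signs. This transports sums between index types such as `Fin (p +
q)` and `Fin (q + p)`. -/
theorem altSum_comp_equiv (T : (ι → V) → ℝ) (e : κ ≃ ι) (v : ι → V) :
    altSum (fun w : κ → V => T (w ∘ e.symm)) (v ∘ e) = altSum T v := by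
  simp only [altSum]
  rw [← Equiv.sum_comp e.permCongr]
  refine Finset.sum_congr rfl fun σ _ => ?_
  rw [Equiv.Perm.sign_permCongr]
  rfl

/-- Signed sums over a family of permutations are absorbed by `altSum`. -/
theorem altSum_absorb {J : Type*} [Fintype J] (ρ : J → Equiv.Perm ι) (T : (ι → V) → ℝ)
    (v : ι → V) :
    altSum (fun w => ∑ j, ((Equiv.Perm.sign (ρ j) : ℤ) : ℝ) * T (w ∘ ρ j)) v =
      Fintype.card J * altSum T v := by
  have h : altSum (fun w => ∑ j, ((Equiv.Perm.sign (ρ j) : ℤ) : ℝ) * T (w ∘ ρ j)) v =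
      ∑ j, ((Equiv.Perm.sign (ρ j) : ℤ) : ℝ) * altSum (fun w => T (w ∘ ρ j)) v := by
    simp only [altSum, Finset.mul_sum]
    rw [Finset.sum_comm]
    exact Finset.sum_congr rfl fun _ _ => Finset.sum_congr rfl fun _ _ => by ring
  rw [h]
  simp only [altSum_comp_perm, ← mul_assoc, sign_mul_self, one_mul, Finset.sum_const,
    Finset.card_univ, nsmul_eq_mul]

theorem altSum_const_mul (c : ℝ) (T : (ι → V) → ℝ) (v : ι → V) :
    altSum (fun w => c * T w) v = c * altSum T v := by
  simp only [altSum, Finset.mul_sum]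
  exact Finset.sum_congr rfl fun _ _ => by ring

theorem altSum_of_alternating [AddCommGroup V] [Module ℝ V] [TopologicalSpace V]
    (a : V [⋀^ι]→L[ℝ] ℝ) (v : ι → V) :
    altSum a v = (Fintype.card ι).factorial * a v := by
  have h (σ : Equiv.Perm ι) : a (v ∘ σ) = ((Equiv.Perm.sign σ : ℤ) : ℝ) * a v := by
    have := a.toAlternatingMap.map_perm v σ
    simpa [Units.smul_def] using this
  simp only [altSum, h, ← mul_assoc, sign_mul_self, one_mul, Finset.sum_const, Finset.card_univ,
    nsmul_eq_mul, Fintype.card_perm]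

end AltSum

/-! ### Block permutations and their signs. -/

section Blocks

variable {m r : ℕ}

/-- The permutation of `Fin (m + r)` acting by `τ` on the first `m` indices. -/
def permLeft (r : ℕ) (τ : Equiv.Perm (Fin m)) : Equiv.Perm (Fin (m + r)) :=
  finSumFinEquiv.permCongr (Equiv.Perm.sumCongr τ 1)

/-- The permutation of `Fin (m + r)` acting by `τ` on the last `r` indices. -/
def permRight (m : ℕ) (τ : Equiv.Perm (Fin r)) : Equiv.Perm (Fin (m + r)) :=
  finSumFinEquiv.permCongr (Equiv.Perm.sumCongr 1 τ)

theorem sign_permLeft (τ : Equiv.Perm (Fin m)) :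
    Equiv.Perm.sign (permLeft r τ) = Equiv.Perm.sign τ := by
  simp [permLeft]

theorem sign_permRight (τ : Equiv.Perm (Fin r)) :
    Equiv.Perm.sign (permRight m τ) = Equiv.Perm.sign τ := by
  simp [permRight]

theorem permLeft_castAdd (τ : Equiv.Perm (Fin m)) (i : Fin m) :
    permLeft r τ (Fin.castAdd r i) = Fin.castAdd r (τ i) := by
  simp [permLeft, Equiv.permCongr_apply]

theorem permLeft_natAdd (τ : Equiv.Perm (Fin m)) (i : Fin r) :
    permLeft r τ (Fin.natAdd m i) = Fin.natAdd m i := by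
  simp [permLeft, Equiv.permCongr_apply]

theorem permRight_castAdd (τ : Equiv.Perm (Fin r)) (i : Fin m) :
    permRight m τ (Fin.castAdd r i) = Fin.castAdd r i := by
  simp [permRight, Equiv.permCongr_apply]

theorem permRight_natAdd (τ : Equiv.Perm (Fin r)) (i : Fin r) :
    permRight m τ (Fin.natAdd m i) = Fin.natAdd m (τ i) := by
  simp [permRight, Equiv.permCongr_apply]

theorem coe_finRotate_pow (n k : ℕ) (i : Fin (n + 1)) :
    (((finRotate (n + 1)) ^ k) i : ℕ) = (i + k) % (n + 1) := by
  induction k with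
  | zero => simp [Nat.mod_eq_of_lt i.2]
  | succ k ih =>
    rw [pow_succ', Equiv.Perm.mul_apply, finRotate_apply, Fin.val_add, ih,
      Fin.val_one', ← Nat.add_mod, add_assoc]

/-- The permutation of `Fin (p + q)` exchanging the first `p` and the last `q` places. -/
theorem exists_perm_swap_blocks (p q : ℕ) : ∃ π : Equiv.Perm (Fin (p + q)),
    ((Equiv.Perm.sign π : ℤ) : ℝ) = (-1) ^ (p * q) ∧
    (∀ j : Fin q, π (Fin.cast (add_comm q p) (Fin.castAdd p j)) = Fin.natAdd p j) ∧
    ∀ i : Fin p, π (Fin.cast (add_comm q p) (Fin.natAdd q i)) = Fin.castAdd q i := by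
  rcases Nat.eq_zero_or_pos (p + q) with h0 | h0
  · obtain ⟨rfl, rfl⟩ : p = 0 ∧ q = 0 := by omega
    exact ⟨1, by simp, fun j => j.elim0, fun i => i.elim0⟩
  obtain ⟨n, hn⟩ : ∃ n, p + q = n + 1 := ⟨p + q - 1, by omega⟩
  -- The block swap is the cyclic shift by `p` places. A one-step rotation of `n + 1` points has
  -- sign `(-1)^n`, so the shift has sign `(-1)^(n * p)` with `n = p + q - 1`; this has the parity
  -- of `p * q`.
  refine ⟨(finCongr hn).symm.permCongr ((finRotate (n + 1)) ^ p), ?_, ?_, ?_⟩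
  · rw [Equiv.Perm.sign_permCongr, map_pow, sign_finRotate]
    have h : Even (n * p + p * q) := by
      have : n * p + p * q = p * (p - 1) + 2 * (p * q) := by
        rcases p with _ | p
        · simp
        · have : n = p + q := by omega
          subst this
          simp only [Nat.add_sub_cancel]
          ring
      rw [this]
      exact (Nat.even_mul_pred_self p).add (even_two_mul _)
    push_cast
    rw [← pow_mul]
    replace h := Nat.even_add.1 h
    rcases Nat.even_or_odd (p * q) with h' | h'
    · rw [h'.neg_one_pow, (h.2 h').neg_one_pow]
    · rw [h'.neg_one_pow, (Nat.not_even_iff_odd.1 (mt h.1 (Nat.not_even_iff_odd.2 h'))).neg_one_pow]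
  · intro j
    ext
    simp only [Equiv.permCongr_apply, finCongr_symm, finCongr_apply, Fin.val_cast,
      coe_finRotate_pow, Fin.val_castAdd, Fin.val_natAdd]
    rw [Nat.mod_eq_of_lt (by omega), add_comm]
  · intro i
    ext
    simp only [Equiv.permCongr_apply, finCongr_symm, finCongr_apply, Fin.val_cast,
      coe_finRotate_pow, Fin.val_castAdd, Fin.val_natAdd]
    rw [show q + (i : ℕ) + p = i + (n + 1) by omega, Nat.add_mod_right, Nat.mod_eq_of_lt (by omega)]

end Blocks

/-! ### Commutativity, associativity and unit of the wedge product. -/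

section WedgeAlgebra

variable {V : Type*} [AddCommGroup V] [Module ℝ V] [TopologicalSpace V] {p q r : ℕ}

theorem wedge_eq_altSum (a : V [⋀^Fin p]→L[ℝ] ℝ) (b : V [⋀^Fin q]→L[ℝ] ℝ) (v : Fin (p + q) → V) :
    wedge a b v = ((p.factorial : ℝ) * (q.factorial : ℝ))⁻¹ *
      altSum (fun w => a (w ∘ Fin.castAdd q) * b (w ∘ Fin.natAdd p)) v :=
  wedge_apply a b v

/-- The block swap turns one summand into the other, and its sign is the factor `(-1)^(p * q)`. -/
theorem wedge_comm (a : V [⋀^Fin p]→L[ℝ] ℝ) (b : V [⋀^Fin q]→L[ℝ] ℝ) (v : Fin (p + q) → V) :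
    wedge a b v = (-1) ^ (p * q) * wedge b a (v ∘ Fin.cast (add_comm q p)) := by
  obtain ⟨π, hs, h1, h2⟩ := exists_perm_swap_blocks p q
  have h := altSum_comp_equiv (fun w : Fin (p + q) → V =>
    b (w ∘ Fin.cast (add_comm q p) ∘ Fin.castAdd p) *
      a (w ∘ Fin.cast (add_comm q p) ∘ Fin.natAdd q)) (finCongr (add_comm q p)) v
  have h' := altSum_comp_perm (fun w : Fin (p + q) → V =>
    b (w ∘ Fin.cast (add_comm q p) ∘ Fin.castAdd p) *
      a (w ∘ Fin.cast (add_comm q p) ∘ Fin.natAdd q)) π v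
  have e1 : (π ∘ Fin.cast (add_comm q p) ∘ Fin.castAdd p) = Fin.natAdd p := funext h1
  have e2 : (π ∘ Fin.cast (add_comm q p) ∘ Fin.natAdd q) = Fin.castAdd q := funext h2
  simp only [Function.comp_assoc, e1, e2] at h'
  rw [wedge_eq_altSum, wedge_eq_altSum]
  have e3 : altSum (fun w => a (w ∘ Fin.castAdd q) * b (w ∘ Fin.natAdd p)) v =
      (-1) ^ (p * q) * altSum (fun w => b (w ∘ Fin.castAdd p) * a (w ∘ Fin.natAdd q))
        (v ∘ Fin.cast (add_comm q p)) := by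
    rw [← hs]
    simp only [mul_comm (a _)]
    exact h'.trans (congrArg _ h.symm)
  rw [e3, mul_comm (q.factorial : ℝ)]
  ring

/-- The inner alternation runs over permutations of the first `p + q` places. The outer sum absorbs
it with a factor `(p + q)!`, which cancels the normalisation and leaves an expression symmetric in
the bracketing. -/
theorem wedge_wedge_left (a : V [⋀^Fin p]→L[ℝ] ℝ) (b : V [⋀^Fin q]→L[ℝ] ℝ)
    (c : V [⋀^Fin r]→L[ℝ] ℝ) (v : Fin (p + q + r) → V) :
    wedge (wedge a b) c v = ((p.factorial : ℝ) * q.factorial * r.factorial)⁻¹ *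
      altSum (fun w => a (w ∘ Fin.castAdd r ∘ Fin.castAdd q) *
        b (w ∘ Fin.castAdd r ∘ Fin.natAdd p) * c (w ∘ Fin.natAdd (p + q))) v := by
  have h := altSum_absorb (permLeft (m := p + q) r)
    (fun w : Fin (p + q + r) → V => a (w ∘ Fin.castAdd r ∘ Fin.castAdd q) *
        b (w ∘ Fin.castAdd r ∘ Fin.natAdd p) * c (w ∘ Fin.natAdd (p + q))) v
  have e1 (τ) : permLeft (m := p + q) r τ ∘ Fin.castAdd r = Fin.castAdd r ∘ τ :=
    funext (permLeft_castAdd τ)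
  have e2 (τ) : permLeft (m := p + q) r τ ∘ Fin.natAdd (p + q) = Fin.natAdd (p + q) :=
    funext (permLeft_natAdd τ)
  have e (w : Fin (p + q + r) → V) :
      wedge a b (w ∘ Fin.castAdd r) * c (w ∘ Fin.natAdd (p + q)) =
      ((p.factorial : ℝ) * q.factorial)⁻¹ *
        ∑ τ, ((Equiv.Perm.sign (permLeft r τ) : ℤ) : ℝ) *
          (a ((w ∘ permLeft r τ) ∘ Fin.castAdd r ∘ Fin.castAdd q) *
          b ((w ∘ permLeft r τ) ∘ Fin.castAdd r ∘ Fin.natAdd p) *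
          c ((w ∘ permLeft r τ) ∘ Fin.natAdd (p + q))) := by
    rw [wedge_eq_altSum, altSum, mul_assoc, Finset.sum_mul]
    congr 1
    refine Finset.sum_congr rfl fun τ _ => ?_
    simp only [sign_permLeft, Function.comp_assoc, e2]
    simp only [← Function.comp_assoc (permLeft r τ), e1, mul_assoc, Function.comp_assoc]
  rw [wedge_eq_altSum]
  simp only [e]
  rw [altSum_const_mul, h, Fintype.card_perm, Fintype.card_fin]
  have := Nat.factorial_ne_zero (p + q)
  field_simp

theorem wedge_wedge_right (a : V [⋀^Fin p]→L[ℝ] ℝ) (b : V [⋀^Fin q]→L[ℝ] ℝ)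
    (c : V [⋀^Fin r]→L[ℝ] ℝ) (v : Fin (p + (q + r)) → V) :
    wedge a (wedge b c) v = ((p.factorial : ℝ) * q.factorial * r.factorial)⁻¹ *
      altSum (fun w => a (w ∘ Fin.castAdd (q + r)) *
        b (w ∘ Fin.natAdd p ∘ Fin.castAdd r) * c (w ∘ Fin.natAdd p ∘ Fin.natAdd q)) v := by
  have h := altSum_absorb (permRight (r := q + r) p)
    (fun w : Fin (p + (q + r)) → V => a (w ∘ Fin.castAdd (q + r)) *
        b (w ∘ Fin.natAdd p ∘ Fin.castAdd r) * c (w ∘ Fin.natAdd p ∘ Fin.natAdd q)) v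
  have e1 (τ) : permRight (r := q + r) p τ ∘ Fin.castAdd (q + r) = Fin.castAdd (q + r) :=
    funext (permRight_castAdd τ)
  have e2 (τ) : permRight (r := q + r) p τ ∘ Fin.natAdd p = Fin.natAdd p ∘ τ :=
    funext (permRight_natAdd τ)
  have e (w : Fin (p + (q + r)) → V) :
      a (w ∘ Fin.castAdd (q + r)) * wedge b c (w ∘ Fin.natAdd p) =
      ((q.factorial : ℝ) * r.factorial)⁻¹ *
        ∑ τ, ((Equiv.Perm.sign (permRight p τ) : ℤ) : ℝ) *
          (a ((w ∘ permRight p τ) ∘ Fin.castAdd (q + r)) *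
          b ((w ∘ permRight p τ) ∘ Fin.natAdd p ∘ Fin.castAdd r) *
          c ((w ∘ permRight p τ) ∘ Fin.natAdd p ∘ Fin.natAdd q)) := by
    rw [wedge_eq_altSum, altSum, mul_left_comm, Finset.mul_sum]
    congr 1
    refine Finset.sum_congr rfl fun τ _ => ?_
    simp only [sign_permRight, Function.comp_assoc, e1]
    simp only [← Function.comp_assoc (permRight p τ), e2, Function.comp_assoc]
    ring
  rw [wedge_eq_altSum]
  simp only [e]
  rw [altSum_const_mul, h, Fintype.card_perm, Fintype.card_fin]
  have := Nat.factorial_ne_zero (q + r)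
  field_simp

theorem wedge_assoc (a : V [⋀^Fin p]→L[ℝ] ℝ) (b : V [⋀^Fin q]→L[ℝ] ℝ)
    (c : V [⋀^Fin r]→L[ℝ] ℝ) (v : Fin (p + q + r) → V) :
    wedge (wedge a b) c v = wedge a (wedge b c) (v ∘ Fin.cast (add_assoc p q r).symm) := by
  rw [wedge_wedge_left, wedge_wedge_right,
    ← altSum_comp_equiv _ (finCongr (add_assoc p q r).symm) v]
  congr 2
  funext w
  refine congrArg₂ (· * ·) (congrArg₂ (· * ·) (congrArg a ?_) (congrArg b ?_)) (congrArg c ?_)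
  all_goals
    funext i
    refine congrArg w (Fin.ext ?_)
    simp [add_assoc]

/-- Alternating the already alternating `b` multiplies it by `q!`, which the normalisation cancels.
-/
theorem wedge_one_left (b : V [⋀^Fin q]→L[ℝ] ℝ) (v : Fin (0 + q) → V) :
    wedge (ContinuousAlternatingMap.constOfIsEmpty ℝ V (Fin 0) (1 : ℝ)) b v =
      b (v ∘ Fin.cast (zero_add q).symm) := by
  have h := altSum_of_alternating b (v ∘ Fin.cast (zero_add q).symm)
  rw [wedge_eq_altSum, ← altSum_comp_equiv _ (finCongr (zero_add q).symm) v]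
  have e : (fun w : Fin q → V => ContinuousAlternatingMap.constOfIsEmpty ℝ V (Fin 0) (1 : ℝ)
      ((w ∘ (finCongr (zero_add q).symm).symm) ∘ Fin.castAdd q) *
      b ((w ∘ (finCongr (zero_add q).symm).symm) ∘ Fin.natAdd 0)) = b := by
    funext w
    simp only [ContinuousAlternatingMap.constOfIsEmpty_apply, one_mul]
    congr 1
    funext i
    refine congrArg w (Fin.ext ?_)
    simp
  rw [e]
  refine (congrArg _ h).trans ?_
  have := Nat.factorial_ne_zero q
  simp only [Fintype.card_fin, Nat.factorial_zero, Nat.cast_one, one_mul]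
  field_simp

end WedgeAlgebra

/-! ### The Leibniz rule on a normed space. -/

section Leibniz

variable {E : Type*} [NormedAddCommGroup E] [NormedSpace ℝ E] {p q n : ℕ}

open ContinuousAlternatingMap

/-- Moving the `i`-th argument to the front is a cycle of sign `(-1)^i`. In this form the sum can be
absorbed by `altSum_absorb`. -/
theorem alternatizeUncurryFin_eq_sum_sign (f : E →L[ℝ] E [⋀^Fin n]→L[ℝ] ℝ)
    (v : Fin (n + 1) → E) :
    alternatizeUncurryFin f v = ∑ i : Fin (n + 1),
      ((Equiv.Perm.sign (Fin.cycleRange i).symm : ℤ) : ℝ) *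
        f (v ((Fin.cycleRange i).symm 0)) (v ∘ (Fin.cycleRange i).symm ∘ Fin.succ) := by
  rw [alternatizeUncurryFin_apply]
  refine Finset.sum_congr rfl fun i _ => ?_
  have h : v ∘ (Fin.cycleRange i).symm ∘ Fin.succ = i.removeNth v := by
    funext j
    simp [Fin.removeNth_apply]
  rw [h, Fin.cycleRange_symm_zero, Equiv.Perm.sign_symm, Fin.sign_cycleRange]
  simp

/-- Absorbing the `p + 1` cycles reduces the normalising factor `1 / (p + 1)!` to `1 / p!`. -/
theorem wedge_alternatizeUncurryFin (f : E →L[ℝ] E [⋀^Fin p]→L[ℝ] ℝ) (b : E [⋀^Fin q]→L[ℝ] ℝ)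
    (v : Fin (p + 1 + q) → E) :
    wedge (alternatizeUncurryFin f) b v = ((p.factorial : ℝ) * q.factorial)⁻¹ *
      altSum (fun w => f (w (Fin.castAdd q 0)) (w ∘ Fin.castAdd q ∘ Fin.succ) *
        b (w ∘ Fin.natAdd (p + 1))) v := by
  have h := altSum_absorb (fun i : Fin (p + 1) => permLeft q (Fin.cycleRange i).symm)
    (fun w : Fin (p + 1 + q) → E => f (w (Fin.castAdd q 0)) (w ∘ Fin.castAdd q ∘ Fin.succ) *
        b (w ∘ Fin.natAdd (p + 1))) v
  have e1 (τ) : permLeft (m := p + 1) q τ ∘ Fin.castAdd q = Fin.castAdd q ∘ τ :=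
    funext (permLeft_castAdd τ)
  have e2 (τ) : permLeft (m := p + 1) q τ ∘ Fin.natAdd (p + 1) = Fin.natAdd (p + 1) :=
    funext (permLeft_natAdd τ)
  have e (w : Fin (p + 1 + q) → E) :
      alternatizeUncurryFin f (w ∘ Fin.castAdd q) * b (w ∘ Fin.natAdd (p + 1)) =
        ∑ i : Fin (p + 1), ((Equiv.Perm.sign (permLeft q (Fin.cycleRange i).symm) : ℤ) : ℝ) *
          (f ((w ∘ permLeft q (Fin.cycleRange i).symm) (Fin.castAdd q 0))
            ((w ∘ permLeft q (Fin.cycleRange i).symm) ∘ Fin.castAdd q ∘ Fin.succ) *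
          b ((w ∘ permLeft q (Fin.cycleRange i).symm) ∘ Fin.natAdd (p + 1))) := by
    rw [alternatizeUncurryFin_eq_sum_sign, Finset.sum_mul]
    refine Finset.sum_congr rfl fun i _ => ?_
    simp only [sign_permLeft, Function.comp_assoc, e2]
    simp only [← Function.comp_assoc (permLeft q _), e1, mul_assoc, Function.comp_assoc]
    simp only [Function.comp_apply, permLeft_castAdd]
  rw [wedge_eq_altSum]
  simp only [e]
  rw [h, Fintype.card_fin, Nat.factorial_succ]
  push_cast
  field_simp

/-- The left side is already alternating, so alternating it once more multiplies it by `(p + q +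
1)!`. Absorbing the cycles gives `p + q + 1` and absorbing the permutations that fix `0` gives `(p +
q)!`; cancelling the common factor avoids any explicit coset decomposition. -/
theorem alternatizeUncurryFin_wedge (f : E →L[ℝ] E [⋀^Fin p]→L[ℝ] ℝ) (b : E [⋀^Fin q]→L[ℝ] ℝ)
    (g : E →L[ℝ] E [⋀^Fin (p + q)]→L[ℝ] ℝ) (hg : ∀ h, g h = wedge (f h) b)
    (v : Fin (p + q + 1) → E) :
    alternatizeUncurryFin g v = ((p.factorial : ℝ) * q.factorial)⁻¹ *
      altSum (fun w => f (w 0) (w ∘ Fin.succ ∘ Fin.castAdd q) *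
        b (w ∘ Fin.succ ∘ Fin.natAdd p)) v := by
  set T : (Fin (p + q + 1) → E) → ℝ := fun w => f (w 0) (w ∘ Fin.succ ∘ Fin.castAdd q) *
    b (w ∘ Fin.succ ∘ Fin.natAdd p) with hT
  have h1 := altSum_absorb (fun i : Fin (p + q + 1) => (Fin.cycleRange i).symm)
    (fun w : Fin (p + q + 1) → E => g (w 0) (w ∘ Fin.succ)) v
  have h2 := altSum_absorb
    (fun τ : Equiv.Perm (Fin (p + q)) => Equiv.Perm.decomposeFin.symm (0, τ)) T v
  have e1 : alternatizeUncurryFin g = fun w : Fin (p + q + 1) → E => ∑ i : Fin (p + q + 1),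
      ((Equiv.Perm.sign (Fin.cycleRange i).symm : ℤ) : ℝ) *
        g ((w ∘ (Fin.cycleRange i).symm) 0) ((w ∘ (Fin.cycleRange i).symm) ∘ Fin.succ) :=
    funext (alternatizeUncurryFin_eq_sum_sign g)
  have es (τ : Equiv.Perm (Fin (p + q))) :
      Equiv.Perm.decomposeFin.symm (0, τ) ∘ Fin.succ = Fin.succ ∘ τ := by
    funext i
    simp
  have e2 (w : Fin (p + q + 1) → E) : g (w 0) (w ∘ Fin.succ) =
      ((p.factorial : ℝ) * q.factorial)⁻¹ * ∑ τ : Equiv.Perm (Fin (p + q)),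
        ((Equiv.Perm.sign (Equiv.Perm.decomposeFin.symm (0, τ)) : ℤ) : ℝ) *
          T (w ∘ Equiv.Perm.decomposeFin.symm (0, τ)) := by
    rw [hg, wedge_eq_altSum, altSum]
    congr 1
    refine Finset.sum_congr rfl fun τ _ => ?_
    simp only [hT, Equiv.Perm.decomposeFin.symm_sign, if_true, one_mul, Function.comp_apply,
      Equiv.Perm.decomposeFin_symm_apply_zero]
    simp only [Function.comp_assoc]
    simp only [← Function.comp_assoc _ Fin.succ, es]
    simp only [Function.comp_assoc]
  have h3 := altSum_of_alternating (alternatizeUncurryFin g) v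
  rw [e1] at h3
  simp only [e2] at h1
  rw [altSum_const_mul, h2] at h1
  simp only [e2] at h3
  rw [h1] at h3
  simp only [Fintype.card_fin, Fintype.card_perm, Nat.factorial_succ] at h3
  rw [e1]
  simp only [e2]
  have : ((p + q).factorial : ℝ) ≠ 0 := Nat.cast_ne_zero.2 (Nat.factorial_ne_zero _)
  have h' : (((p + q + 1 : ℕ) : ℝ)) ≠ 0 := Nat.cast_ne_zero.2 (Nat.succ_ne_zero _)
  refine mul_left_cancel₀ (mul_ne_zero h' this) ?_
  rw [Nat.cast_mul] at h3
  rw [← h3]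
  ring

theorem alternatizeUncurryFin_wedge_left (f : E →L[ℝ] E [⋀^Fin p]→L[ℝ] ℝ)
    (b : E [⋀^Fin q]→L[ℝ] ℝ) (g : E →L[ℝ] E [⋀^Fin (p + q)]→L[ℝ] ℝ)
    (hg : ∀ h, g h = wedge (f h) b) (v : Fin (p + q + 1) → E) :
    alternatizeUncurryFin g v =
      wedge (alternatizeUncurryFin f) b (v ∘ Fin.cast (add_right_comm p 1 q)) := by
  rw [alternatizeUncurryFin_wedge f b g hg, wedge_alternatizeUncurryFin,
    ← altSum_comp_equiv _ (finCongr (add_right_comm p 1 q)) v]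
  congr 2
  funext w
  have h0 : (finCongr (add_right_comm p 1 q)).symm 0 = Fin.castAdd q 0 := by
    ext
    simp
  refine congrArg₂ (· * ·) ?_ (congrArg b ?_)
  · simp only [Function.comp_apply, h0]
    refine congrArg _ (funext fun i => congrArg w (Fin.ext ?_))
    simp
  · refine funext fun i => congrArg w (Fin.ext ?_)
    simp
    omega

theorem alternatizeUncurryFin_cast {m : ℕ} (h : m = n) (c : ℝ)
    (g : E →L[ℝ] E [⋀^Fin n]→L[ℝ] ℝ) (g' : E →L[ℝ] E [⋀^Fin m]→L[ℝ] ℝ)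
    (hg : ∀ u w, g u w = c * g' u (w ∘ Fin.cast h)) (v : Fin (n + 1) → E) :
    alternatizeUncurryFin g v =
      c * alternatizeUncurryFin g' (v ∘ Fin.cast (congrArg (· + 1) h)) := by
  subst h
  have : g = c • g' := by
    ext u w
    exact hg u w
  rw [this, alternatizeUncurryFin_smul]
  rfl

/-- Graded commutativity reduces this to the left-hand case: the two swaps cost `p * q` and `(q + 1)
* p` signs, which leaves `(-1)^p`. -/
theorem alternatizeUncurryFin_wedge_right (a : E [⋀^Fin p]→L[ℝ] ℝ)
    (f : E →L[ℝ] E [⋀^Fin q]→L[ℝ] ℝ) (g : E →L[ℝ] E [⋀^Fin (p + q)]→L[ℝ] ℝ)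
    (hg : ∀ h, g h = wedge a (f h)) (v : Fin (p + q + 1) → E) :
    alternatizeUncurryFin g v = (-1) ^ p * wedge a (alternatizeUncurryFin f) v := by
  let L := (isBoundedBilinearMap_wedge (E := E) (p := q) (q := p)).toContinuousLinearMap
  let g' : E →L[ℝ] E [⋀^Fin (q + p)]→L[ℝ] ℝ := (L.flip a).comp f
  have hg' (u : E) : g' u = wedge (f u) a := rfl
  rw [alternatizeUncurryFin_cast (add_comm q p) ((-1) ^ (p * q)) g g'
      (fun u w => by rw [hg, hg', wedge_comm]),
    alternatizeUncurryFin_wedge_left f a g' hg', wedge_comm, ← mul_assoc, ← pow_add,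
    show p * q + (q + 1) * p = p + 2 * (p * q) by ring, pow_add, pow_mul, neg_one_sq, one_pow,
    mul_one]
  rfl

/-- The product rule for a bounded bilinear map splits the derivative into two terms, each of which
is alternated separately. -/
theorem extDeriv_wedge {α : E → E [⋀^Fin p]→L[ℝ] ℝ} {β : E → E [⋀^Fin q]→L[ℝ] ℝ} {x : E}
    (hα : DifferentiableAt ℝ α x) (hβ : DifferentiableAt ℝ β x) (v : Fin (p + q + 1) → E) :
    extDeriv (fun y => wedge (α y) (β y)) x v =
      wedge (extDeriv α x) (β x) (v ∘ Fin.cast (add_right_comm p 1 q)) +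
        (-1) ^ p * wedge (α x) (extDeriv β x) v := by
  have hb := isBoundedBilinearMap_wedge (E := E) (p := p) (q := q)
  have h := (hb.hasFDerivAt (α x, β x)).comp x (hα.hasFDerivAt.prodMk hβ.hasFDerivAt)
  have h' : fderiv ℝ (fun y => wedge (α y) (β y)) x = _ := h.fderiv
  let L := hb.toContinuousLinearMap
  have e : fderiv ℝ (fun y => wedge (α y) (β y)) x =
      (L.flip (β x)).comp (fderiv ℝ α x) + (L (α x)).comp (fderiv ℝ β x) := by
    rw [h']
    ext1 u
    change wedge (α x) (fderiv ℝ β x u) + wedge (fderiv ℝ α x u) (β x) = _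
    exact add_comm _ _
  rw [extDeriv, e, alternatizeUncurryFin_add, ContinuousAlternatingMap.add_apply,
    alternatizeUncurryFin_wedge_left (fderiv ℝ α x) (β x) _ fun _ => rfl,
    alternatizeUncurryFin_wedge_right (α x) (fderiv ℝ β x) _ fun _ => rfl]
  rfl

end Leibniz

/-! ### The differential graded algebra of forms on a manifold. -/

section ManifoldForms

variable {E : Type*} [NormedAddCommGroup E] [NormedSpace ℝ E]
  {M : Type*} [TopologicalSpace M] [ChartedSpace E M]

/-- Turns a pointwise identity containing casts into a cast-free one in the direct sum. -/
theorem inclForm_eq_smul {m n : ℕ} (h : m = n) (c : ℝ) (α : Form E M m) (β : Form E M n)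
    (H : ∀ (x : M) (v : Fin m → E), α.1 x v = c * β.1 x (v ∘ Fin.cast h.symm)) :
    inclForm E M m α = c • inclForm E M n β := by
  subst h
  rw [← map_smul]
  exact congrArg _ (Subtype.ext (funext fun x => ContinuousAlternatingMap.ext fun v => H x v))

theorem totalWedge_comm_incl {p q : ℕ} (α : Form E M p) (β : Form E M q) :
    totalWedge E M (inclForm E M p α) (inclForm E M q β) =
      (-1 : ℝ) ^ (p * q) • totalWedge E M (inclForm E M q β) (inclForm E M p α) := by
  rw [totalWedge_incl, totalWedge_incl]
  exact inclForm_eq_smul (add_comm p q) _ _ _ fun x v => wedge_comm (α.1 x) (β.1 x) v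

theorem totalForm_hom_ext {N : Type*} [AddCommGroup N] [Module ℝ N]
    {f g : TotalForm E M →ₗ[ℝ] N}
    (h : ∀ (k : ℕ) (α : Form E M k), f (inclForm E M k α) = g (inclForm E M k α)) : f = g :=
  DirectSum.linearMap_ext ℝ fun k => LinearMap.ext (h k)

theorem totalWedge_assoc (x y z : TotalForm E M) :
    totalWedge E M (totalWedge E M x y) z = totalWedge E M x (totalWedge E M y z) := by
  -- Both sides are written as trilinear maps, so that it suffices to compare them on homogeneous
  -- forms.
  have h : (totalWedge E M).compr₂ (totalWedge E M) =
      ((LinearMap.llcomp ℝ (TotalForm E M) (TotalForm E M) (TotalForm E M)).flip ∘ₗ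
        totalWedge E M).flip ∘ₗ totalWedge E M := by
    refine totalForm_hom_ext fun p α => totalForm_hom_ext fun q β => totalForm_hom_ext fun r γ => ?_
    change totalWedge E M (totalWedge E M (inclForm E M p α) (inclForm E M q β)) (inclForm E M r γ) =
      totalWedge E M (inclForm E M p α) (totalWedge E M (inclForm E M q β) (inclForm E M r γ))
    simp only [totalWedge_incl]
    rw [← one_smul ℝ (inclForm E M (p + (q + r)) _)]
    refine inclForm_eq_smul (add_assoc p q r) _ _ _ fun x v => ?_
    rw [one_mul]
    exact wedge_assoc (α.1 x) (β.1 x) (γ.1 x) v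
  exact LinearMap.congr_fun (LinearMap.congr_fun (LinearMap.congr_fun h x) y) z

theorem totalWedge_one (x : TotalForm E M) : totalWedge E M (inclForm E M 0 Form.one) x = x := by
  have h : totalWedge E M (inclForm E M 0 Form.one) = LinearMap.id := by
    refine totalForm_hom_ext fun q β => ?_
    rw [totalWedge_incl, LinearMap.id_apply, ← one_smul ℝ (inclForm E M q β)]
    refine inclForm_eq_smul (zero_add q) _ _ _ fun x v => ?_
    rw [one_mul]
    exact wedge_one_left (β.1 x) v
  exact LinearMap.congr_fun h x

variable [IsManifold 𝓘(ℝ, E) ∞ M]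

/-- A field of forms is recovered from its coordinate expression in a chart. -/
theorem coordRep_compContinuousLinearMap_mfderiv {k : ℕ} (w : FormField E M k)
    {e : OpenPartialHomeomorph M E} (he : e ∈ atlas E M) {x : M} (hx : x ∈ e.source) :
    (coordRep w e (e x)).compContinuousLinearMap
      (mfderiv 𝓘(ℝ, E) 𝓘(ℝ, E) e x : E →L[ℝ] E) = w x := by
  have hn : (1 : WithTop ℕ∞) ≤ ∞ := by simp
  have : IsManifold 𝓘(ℝ, E) 1 M := IsManifold.of_le hn
  have hd : (mfderiv 𝓘(ℝ, E) 𝓘(ℝ, E) e.symm (e x) : E →L[ℝ] E).comp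
      (mfderiv 𝓘(ℝ, E) 𝓘(ℝ, E) e x : E →L[ℝ] E) = ContinuousLinearMap.id ℝ E := by
    have hev : e.symm ∘ e =ᶠ[𝓝 x] id := e.eventually_left_inverse hx
    have h1 : MDifferentiableAt 𝓘(ℝ, E) 𝓘(ℝ, E) e.symm (e x) :=
      mdifferentiableAt_atlas_symm he (e.map_source hx)
    have h := mfderiv_comp x h1 (mdifferentiableAt_atlas he hx)
    exact h.symm.trans (hev.mfderiv_eq.trans mfderiv_id)
  have aux : ∀ (x' : M) (L : E →L[ℝ] E), x' = x → L = ContinuousLinearMap.id ℝ E →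
      ContinuousAlternatingMap.compContinuousLinearMap (w x') L = w x := by
    rintro x' L rfl rfl
    rfl
  exact aux _ _ (e.left_inv hx) hd

/-- All forms involved are, at `x`, pullbacks of coordinate expressions along the derivative `D` of
the chart, and the wedge product commutes with pullback. The vector space rule therefore applies. -/
theorem Form.d_wedge_apply {p q : ℕ} (α : Form E M p) (β : Form E M q) (x : M)
    (v : Fin (p + q + 1) → E) :
    (Form.d E M (p + q) (α.wedge β)).1 x v =
      ((Form.d E M p α).wedge β).1 x (v ∘ Fin.cast (add_right_comm p 1 q)) +
        (-1) ^ p * (α.wedge (Form.d E M q β)).1 x v := by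
  set e := chartAt E x
  set D : E →L[ℝ] E := mfderiv 𝓘(ℝ, E) 𝓘(ℝ, E) e x
  have hα := coordRep_compContinuousLinearMap_mfderiv α.1 (chart_mem_atlas E x)
    (mem_chart_source E x)
  have hβ := coordRep_compContinuousLinearMap_mfderiv β.1 (chart_mem_atlas E x)
    (mem_chart_source E x)
  have h1 : FormCohomology.wedge ((Form.d E M p α).1 x) (β.1 x) =
      (FormCohomology.wedge (extDeriv (coordRep α.1 e) (e x))
        (coordRep β.1 e (e x))).compContinuousLinearMap D := by
    rw [wedge_compContinuousLinearMap]
    exact congrArg _ hβ.symm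
  have h2 : FormCohomology.wedge (α.1 x) ((Form.d E M q β).1 x) =
      (FormCohomology.wedge (coordRep α.1 e (e x))
        (extDeriv (coordRep β.1 e) (e x))).compContinuousLinearMap D := by
    rw [wedge_compContinuousLinearMap]
    exact congrArg (fun a => FormCohomology.wedge a ((Form.d E M q β).1 x)) hα.symm
  have h3 : coordRep (α.wedge β).1 e =
      fun y => FormCohomology.wedge (coordRep α.1 e y) (coordRep β.1 e y) :=
    funext fun y => coordRep_wedge α.1 β.1 e y
  change extDeriv (coordRep (α.wedge β).1 e) (e x) (D ∘ v) =
    FormCohomology.wedge ((Form.d E M p α).1 x) (β.1 x) (v ∘ Fin.cast (add_right_comm p 1 q)) +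
      (-1) ^ p * FormCohomology.wedge (α.1 x) ((Form.d E M q β).1 x) v
  rw [h1, h2, h3, extDeriv_wedge (α.differentiableAt x) (β.differentiableAt x)]
  rfl

theorem totalD_totalWedge_incl {p : ℕ} (α : Form E M p) (y : TotalForm E M) :
    totalD E M (totalWedge E M (inclForm E M p α) y) =
      totalWedge E M (totalD E M (inclForm E M p α)) y +
        (-1 : ℝ) ^ p • totalWedge E M (inclForm E M p α) (totalD E M y) := by
  have h : totalD E M ∘ₗ totalWedge E M (inclForm E M p α) =
      totalWedge E M (totalD E M (inclForm E M p α)) +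
        (-1 : ℝ) ^ p • totalWedge E M (inclForm E M p α) ∘ₗ totalD E M := by
    refine totalForm_hom_ext fun q β => ?_
    simp only [LinearMap.comp_apply, LinearMap.add_apply, LinearMap.smul_apply, totalWedge_incl,
      totalD_incl]
    rw [← sub_eq_iff_eq_add, ← map_smul]
    refine (map_sub (inclForm E M (p + q + 1)) _ _).symm.trans ?_
    rw [← one_smul ℝ (inclForm E M (p + 1 + q) _)]
    refine inclForm_eq_smul (add_right_comm p q 1) _ _ _ fun x v => ?_
    rw [one_mul]
    exact sub_eq_iff_eq_add.2 (Form.d_wedge_apply α β x v)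
  exact LinearMap.congr_fun h y

/-- The outer derivative needs `dα` on a whole neighbourhood of `x`, whereas `dα` is defined at each
point through the preferred chart there. Chart independence identifies it with `extDeriv` in one
fixed chart, where `d ∘ d = 0` is known. -/
theorem Form.d_d {k : ℕ} (α : Form E M k) : Form.d E M (k + 1) (Form.d E M k α) = 0 := by
  refine Subtype.ext (funext fun x => ?_)
  set e := chartAt E x
  have he : e ∈ atlas E M := chart_mem_atlas E x
  have hx : e x ∈ e.target := mem_chart_target E x
  have hev : coordRep (Form.d E M k α).1 e =ᶠ[𝓝 (e x)] extDeriv (coordRep α.1 e) := by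
    filter_upwards [e.open_target.mem_nhds hx] with y hy
    exact coordRep_extDerivField α he hy
  have h0 : extDeriv (coordRep (Form.d E M k α).1 e) (e x) = 0 := by
    rw [hev.extDeriv_eq]
    refine extDeriv_extDeriv_apply ((α.2 e he).contDiffAt (e.open_target.mem_nhds hx)) ?_
    rw [minSmoothness_of_isRCLikeNormedField]
    exact WithTop.coe_le_coe.2 le_top
  change (extDeriv (coordRep (Form.d E M k α).1 e) (e x)).compContinuousLinearMap _ = _
  rw [h0]
  rfl

theorem totalD_totalD (x : TotalForm E M) : totalD E M (totalD E M x) = 0 := by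
  have h : totalD E M ∘ₗ totalD E M = 0 := by
    refine totalForm_hom_ext fun k α => ?_
    simp only [LinearMap.comp_apply, totalD_incl, Form.d_d, map_zero, LinearMap.zero_apply]
  exact LinearMap.congr_fun h x

end ManifoldForms

/-! ### The shifted grading. -/

section Grading

variable {E : Type*} [NormedAddCommGroup E] [NormedSpace ℝ E]
  {M : Type*} [TopologicalSpace M] [ChartedSpace E M]

theorem inclForm_injective (k : ℕ) : Function.Injective (inclForm E M k) :=
  DirectSum.of_injective k

theorem inclForm_mem {k : ℕ} {i : ℤ} (h : (k : ℤ) + 1 = i) (α : Form E M k) :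
    inclForm E M k α ∈ formGrading E M i :=
  le_iSup₂_of_le (f := fun (k : ℕ) (_ : (k : ℤ) + 1 = i) => LinearMap.range (inclForm E M k)) k h
    le_rfl (LinearMap.mem_range_self _ α)

theorem formGrading_natCast_add_one (k : ℕ) :
    formGrading E M (k + 1) = LinearMap.range (inclForm E M k) := by
  refine le_antisymm (iSup₂_le fun n hn => ?_) ?_
  · obtain rfl : n = k := by omega
    exact le_rfl
  · rintro _ ⟨α, rfl⟩
    exact inclForm_mem rfl α

theorem formGrading_of_nonpos {i : ℤ} (hi : i ≤ 0) : formGrading E M i = ⊥ :=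
  le_bot_iff.1 (iSup₂_le fun n hn => by omega)

theorem eq_zero_or_eq_inclForm_of_mem {i : ℤ} {x : TotalForm E M} (hx : x ∈ formGrading E M i) :
    x = 0 ∨ ∃ (k : ℕ) (α : Form E M k), i = k + 1 ∧ x = inclForm E M k α := by
  rcases le_or_gt i 0 with hi | hi
  · rw [formGrading_of_nonpos hi] at hx
    exact Or.inl hx
  · obtain ⟨k, rfl⟩ : ∃ k : ℕ, i = k + 1 := ⟨(i - 1).toNat, by omega⟩
    rw [formGrading_natCast_add_one] at hx
    obtain ⟨α, rfl⟩ := hx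
    exact Or.inr ⟨k, α, rfl, rfl⟩

theorem formGrading_le_ker_component {i : ℤ} {k : ℕ} (h : (k : ℤ) + 1 ≠ i) :
    formGrading E M i ≤ LinearMap.ker (DirectSum.component ℝ ℕ (fun k => Form E M k) k) := by
  refine iSup₂_le fun n hn => ?_
  rintro _ ⟨α, rfl⟩
  exact DirectSum.of_eq_of_ne n k α (by omega)

theorem isInternal_formGrading : DirectSum.IsInternal (formGrading E M) := by
  refine DirectSum.isInternal_submodule_of_iSupIndep_of_iSup_eq_top (fun i => ?_) ?_
  · rw [Submodule.disjoint_def]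
    intro x hx hx'
    refine DFinsupp.ext fun k => ?_
    -- Membership in the other graded pieces kills the component of degree `i`; membership in the
    -- `i`-th piece kills all the others.
    by_cases hk : (k : ℤ) + 1 = i
    · have h : ⨆ (j) (_ : j ≠ i), formGrading E M j ≤
          LinearMap.ker (DirectSum.component ℝ ℕ (fun k => Form E M k) k) :=
        iSup₂_le fun j hj => formGrading_le_ker_component (by omega)
      exact h hx'
    · exact formGrading_le_ker_component hk hx
  · rw [eq_top_iff]
    intro x _
    induction x using DirectSum.induction_on with
    | zero => exact zero_mem _
    | of k α => exact Submodule.mem_iSup_of_mem ((k : ℤ) + 1) (inclForm_mem rfl α)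
    | add x y hx hy => exact add_mem (hx trivial) (hy trivial)

theorem subsingleton_poissonLikeCohomology {Φ : TotalForm E M →ₗ[ℝ] TotalForm E M} {p i : ℤ}
    (h : IsCoboundaryOperator (formGrading E M) p Φ) (hi : i ≤ 0) :
    Subsingleton (PoissonLikeCohomology h i) := by
  have h0 (x : cocycles (formGrading E M) Φ i) : x = 0 := by
    have hx := x.2.1
    rw [formGrading_of_nonpos hi] at hx
    exact Subtype.ext hx
  refine ⟨fun x y => ?_⟩
  obtain ⟨x, rfl⟩ := Submodule.Quotient.mk_surjective _ x
  obtain ⟨y, rfl⟩ := Submodule.Quotient.mk_surjective _ y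
  rw [h0 x, h0 y]

/-! ### The bracket: grading, skew symmetry and the Jacobi identity. -/

variable [IsManifold 𝓘(ℝ, E) ∞ M]

theorem totalD_mem {i : ℤ} {x : TotalForm E M} (hx : x ∈ formGrading E M i) :
    totalD E M x ∈ formGrading E M (i + 1) := by
  rcases eq_zero_or_eq_inclForm_of_mem hx with rfl | ⟨k, α, rfl, rfl⟩
  · rw [map_zero]
    exact zero_mem _
  · rw [totalD_incl]
    exact inclForm_mem (by push_cast; rfl) _

theorem superBracket_incl_left {p : ℕ} (φ : Form E M p) (y : TotalForm E M) :
    superBracket E M (inclForm E M p φ) y =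
      (-1 : ℝ) ^ p • totalD E M (totalWedge E M (inclForm E M p φ) y) := by
  have h : superBracket E M (inclForm E M p φ) =
      (-1 : ℝ) ^ p • totalD E M ∘ₗ totalWedge E M (inclForm E M p φ) := by
    refine totalForm_hom_ext fun q β => ?_
    rw [superBracket_incl, LinearMap.smul_apply, LinearMap.comp_apply, totalWedge_incl, totalD_incl]
  exact LinearMap.congr_fun h y

theorem superBracket_mem {i j : ℤ} {x y : TotalForm E M} (hx : x ∈ formGrading E M i)
    (hy : y ∈ formGrading E M j) : superBracket E M x y ∈ formGrading E M (i + j) := by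
  rcases eq_zero_or_eq_inclForm_of_mem hx with rfl | ⟨a, α, rfl, rfl⟩
  · simp
  rcases eq_zero_or_eq_inclForm_of_mem hy with rfl | ⟨b, β, rfl, rfl⟩
  · simp
  rw [superBracket_incl]
  exact Submodule.smul_mem _ _ (inclForm_mem (by push_cast; ring) _)

theorem neg_one_pow_mul_self (n : ℕ) : (-1 : ℝ) ^ n * (-1) ^ n = 1 := by
  rw [← mul_pow]
  simp

theorem superBracket_skew_incl {a b : ℕ} (α : Form E M a) (β : Form E M b) :
    superBracket E M (inclForm E M a α) (inclForm E M b β) + (-1 : ℝ) ^ ((a + 1) * (b + 1)) •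
      superBracket E M (inclForm E M b β) (inclForm E M a α) = 0 := by
  rw [superBracket_incl_left, superBracket_incl_left, totalWedge_comm_incl β α, map_smul,
    smul_smul, smul_smul, ← add_smul]
  refine smul_eq_zero_of_left ?_ _
  rw [show (a + 1) * (b + 1) = b * a + b + a + 1 by ring]
  simp only [pow_add, pow_one]
  linear_combination (-(-1 : ℝ) ^ a * (-1) ^ b * (-1) ^ b) * neg_one_pow_mul_self (b * a) -
    (-1 : ℝ) ^ a * neg_one_pow_mul_self b

/-- The double bracket of homogeneous forms. -/
theorem superBracket_superBracket_incl {a b c : ℕ} (α : Form E M a) (β : Form E M b)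
    (γ : Form E M c) :
    superBracket E M (superBracket E M (inclForm E M a α) (inclForm E M b β)) (inclForm E M c γ) =
      totalWedge E M (inclForm E M a α) (totalWedge E M (totalD E M (inclForm E M b β))
        (totalD E M (inclForm E M c γ))) -
      ((-1 : ℝ) ^ ((a + 1) * (b + 1)) * (-1) ^ ((a + 1) * (c + 1))) •
        totalWedge E M (inclForm E M b β) (totalWedge E M (totalD E M (inclForm E M c γ))
          (totalD E M (inclForm E M a α))) := by
  -- As `d(α ∧ β)` is closed, only the term with `dγ` survives, and its Leibniz sign cancels the
  -- sign of the outer bracket.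
  have h1 : superBracket E M (superBracket E M (inclForm E M a α) (inclForm E M b β))
      (inclForm E M c γ) = (-1 : ℝ) ^ a • totalWedge E M
        (totalD E M (totalWedge E M (inclForm E M a α) (inclForm E M b β)))
        (totalD E M (inclForm E M c γ)) := by
    rw [superBracket_incl, map_smul, LinearMap.smul_apply, superBracket_incl_left,
      totalD_totalWedge_incl, ← totalD_incl, totalD_totalD, map_zero, LinearMap.zero_apply,
      zero_add, totalWedge_incl, smul_smul (_ ^ (a + b + 1)), neg_one_pow_mul_self, one_smul]
  -- Moves `dα`, of form degree `a + 1`, past `β` and `dγ` to reach the cyclic order.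
  have h2 : totalWedge E M (totalD E M (inclForm E M a α))
      (totalWedge E M (inclForm E M b β) (totalD E M (inclForm E M c γ))) =
      ((-1 : ℝ) ^ ((a + 1) * b) * (-1) ^ ((a + 1) * (c + 1))) •
        totalWedge E M (inclForm E M b β) (totalWedge E M (totalD E M (inclForm E M c γ))
          (totalD E M (inclForm E M a α))) := by
    rw [← totalWedge_assoc, totalD_incl, totalWedge_comm_incl, map_smul, LinearMap.smul_apply,
      totalWedge_assoc, totalD_incl, totalWedge_comm_incl (Form.d E M a α), map_smul, smul_smul]
  rw [h1, totalD_totalWedge_incl, map_add, LinearMap.add_apply, map_smul, LinearMap.smul_apply,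
    totalWedge_assoc, totalWedge_assoc, h2, smul_add, smul_smul, smul_smul, neg_one_pow_mul_self,
    one_smul, add_comm, sub_eq_add_neg, ← neg_smul]
  congr 2
  rw [show (a + 1) * (b + 1) = (a + 1) * b + a + 1 by ring]
  simp only [pow_add, pow_one]
  ring

theorem superBracket_jacobi_incl {a b c : ℕ} (α : Form E M a) (β : Form E M b) (γ : Form E M c) :
    (-1 : ℝ) ^ ((a + 1) * (c + 1)) • superBracket E M
        (superBracket E M (inclForm E M a α) (inclForm E M b β)) (inclForm E M c γ) +
      (-1 : ℝ) ^ ((b + 1) * (a + 1)) • superBracket E M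
        (superBracket E M (inclForm E M b β) (inclForm E M c γ)) (inclForm E M a α) +
      (-1 : ℝ) ^ ((c + 1) * (b + 1)) • superBracket E M
        (superBracket E M (inclForm E M c γ) (inclForm E M a α)) (inclForm E M b β) = 0 := by
  simp only [superBracket_superBracket_incl]
  rw [mul_comm (b + 1) (a + 1), mul_comm (c + 1) (b + 1), mul_comm (c + 1) (a + 1)]
  -- Only the fact that the three signs square to one matters from here on; each cyclic monomial
  -- then occurs twice, with opposite coefficients.
  have hu := neg_one_pow_mul_self ((a + 1) * (b + 1))
  have hv := neg_one_pow_mul_self ((b + 1) * (c + 1))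
  have hw := neg_one_pow_mul_self ((a + 1) * (c + 1))
  generalize (-1 : ℝ) ^ ((a + 1) * (b + 1)) = u at *
  generalize (-1 : ℝ) ^ ((b + 1) * (c + 1)) = v at *
  generalize (-1 : ℝ) ^ ((a + 1) * (c + 1)) = w at *
  match_scalars
  · linear_combination (-w) * hv
  · linear_combination (-u) * hw
  · linear_combination (-v) * hu

theorem isLieSuperalgebra_forms : IsLieSuperalgebra (formGrading E M) (superBracket E M) where
  isInternal := isInternal_formGrading
  bracket_mem _ _ _ hx _ hy := superBracket_mem hx hy
  skew i j x hx y hy := by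
    rcases eq_zero_or_eq_inclForm_of_mem hx with rfl | ⟨a, α, rfl, rfl⟩
    · simp
    rcases eq_zero_or_eq_inclForm_of_mem hy with rfl | ⟨b, β, rfl, rfl⟩
    · simp
    exact_mod_cast superBracket_skew_incl α β
  jacobi i j k x hx y hy z hz := by
    rcases eq_zero_or_eq_inclForm_of_mem hx with rfl | ⟨a, α, rfl, rfl⟩
    · simp
    rcases eq_zero_or_eq_inclForm_of_mem hy with rfl | ⟨b, β, rfl, rfl⟩
    · simp
    rcases eq_zero_or_eq_inclForm_of_mem hz with rfl | ⟨c, γ, rfl, rfl⟩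
    · simp
    exact_mod_cast superBracket_jacobi_incl α β γ

end Grading

/-! ### The operators `d_φ` and de Rham cohomology. -/

section PoissonDifferential

variable {E : Type*} [NormedAddCommGroup E] [NormedSpace ℝ E]
  {M : Type*} [TopologicalSpace M] [ChartedSpace E M] [IsManifold 𝓘(ℝ, E) ∞ M]

theorem poissonD_eq_of_even {p : ℕ} (hp : Even p) (φ : Form E M p) :
    poissonD E M φ = totalD E M ∘ₗ totalWedge E M (inclForm E M p φ) := by
  refine LinearMap.ext fun y => ?_
  rw [poissonD, superBracket_incl_left, hp.neg_one_pow, one_smul]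
  rfl

theorem totalD_totalWedge_of_even {p : ℕ} (hp : Even p) (φ : Form E M p) (y : TotalForm E M) :
    totalD E M (totalWedge E M (inclForm E M p φ) y) =
      totalWedge E M (totalD E M (inclForm E M p φ)) y +
        totalWedge E M (inclForm E M p φ) (totalD E M y) := by
  rw [totalD_totalWedge_incl, hp.neg_one_pow, one_smul]

theorem isCoboundaryOperator_poissonD {p : ℕ} (hp : Even p) (φ : Form E M p)
    (hφ : Form.d E M (p + p) (φ.wedge φ) = 0) :
    IsCoboundaryOperator (formGrading E M) (p + 1) (poissonD E M φ) where
  map_mem i x hx := by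
    rw [add_comm]
    exact superBracket_mem (inclForm_mem rfl φ) hx
  comp_self := by
    have h0 : totalD E M (totalWedge E M (inclForm E M p φ) (inclForm E M p φ)) = 0 := by
      rw [totalWedge_incl, totalD_incl, hφ, map_zero]
    have h1 : totalWedge E M (totalD E M (inclForm E M p φ)) (inclForm E M p φ) =
        totalWedge E M (inclForm E M p φ) (totalD E M (inclForm E M p φ)) := by
      rw [totalD_incl, totalWedge_comm_incl, (hp.mul_left _).neg_one_pow, one_smul]
    -- By `h1`, the Leibniz rule reads `0 = d(φ ∧ φ) = 2 φ ∧ dφ`; differentiating the result yields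
    -- `h3`.
    have h2 : totalWedge E M (inclForm E M p φ) (totalD E M (inclForm E M p φ)) = 0 := by
      rw [totalD_totalWedge_of_even hp, h1, ← two_smul ℝ] at h0
      exact (smul_eq_zero.1 h0).resolve_left two_ne_zero
    have h3 : totalWedge E M (totalD E M (inclForm E M p φ)) (totalD E M (inclForm E M p φ)) = 0 := by
      have h := totalD_totalWedge_of_even hp φ (totalD E M (inclForm E M p φ))
      rwa [h2, totalD_totalD, map_zero, map_zero, add_zero, eq_comm] at h
    refine LinearMap.ext fun y => ?_
    rw [poissonD_eq_of_even hp]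
    simp only [LinearMap.comp_apply, LinearMap.zero_apply]
    rw [totalD_totalWedge_of_even hp, totalD_totalD, map_zero, add_zero,
      totalD_totalWedge_of_even hp, map_add, ← totalWedge_assoc, ← totalWedge_assoc, h3, h1, h2,
      map_zero, LinearMap.zero_apply, LinearMap.zero_apply, add_zero]

theorem Form.d_wedge_self_of_closed {p : ℕ} (hp : Even p) (φ : Form E M p)
    (hφ : Form.d E M p φ = 0) : Form.d E M (p + p) (φ.wedge φ) = 0 := by
  apply inclForm_injective
  rw [← totalD_incl, ← totalWedge_incl, totalD_totalWedge_of_even hp, totalD_incl, hφ, map_zero,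
    map_zero, map_zero, LinearMap.zero_apply, add_zero,
    map_zero]

theorem poissonD_one : poissonD E M Form.one = totalD E M := by
  refine LinearMap.ext fun y => ?_
  rw [poissonD_eq_of_even Even.zero, LinearMap.comp_apply, totalWedge_one]

theorem isCoboundaryOperator_totalD : IsCoboundaryOperator (formGrading E M) 1 (totalD E M) where
  map_mem _ _ hx := totalD_mem hx
  comp_self := LinearMap.ext totalD_totalD

theorem inclForm_mem_cocycles {k : ℕ} {α : Form E M k} :
    inclForm E M k α ∈ cocycles (formGrading E M) (totalD E M) (k + 1) ↔ α ∈ closedForms E M k := by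
  refine ⟨fun h => ?_, fun h => ⟨inclForm_mem rfl α, ?_⟩⟩
  · have h' := LinearMap.mem_ker.1 h.2
    rw [totalD_incl] at h'
    exact inclForm_injective _ (h'.trans (map_zero _).symm)
  · refine LinearMap.mem_ker.2 ?_
    rw [totalD_incl, LinearMap.mem_ker.1 h, map_zero]

theorem inclForm_mem_coboundaries {k : ℕ} {α : Form E M k} :
    inclForm E M k α ∈ coboundaries (formGrading E M) 1 (totalD E M) (k + 1) ↔
      α ∈ exactForms E M k := by
  rw [coboundaries, add_sub_cancel_right]
  cases k with
  | zero =>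
    -- Functions have degree `1`, so their coboundaries come from the zero space in degree `0`, in
    -- agreement with `exactForms` being `⊥` there.
    rw [Nat.cast_zero, formGrading_of_nonpos le_rfl, Submodule.map_bot, Submodule.mem_bot,
      map_eq_zero_iff _ (inclForm_injective 0)]
    rfl
  | succ n =>
    rw [Nat.cast_succ, formGrading_natCast_add_one]
    constructor
    · rintro ⟨_, ⟨β, rfl⟩, h⟩
      rw [totalD_incl] at h
      exact ⟨β, inclForm_injective _ h⟩
    · rintro ⟨β, rfl⟩
      exact ⟨_, ⟨β, rfl⟩, totalD_incl E M β⟩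

/-- Closed `k`-forms are the same as cocycles of degree `k + 1`. -/
def closedFormsEquiv (k : ℕ) :
    closedForms E M k ≃ₗ[ℝ] cocycles (formGrading E M) (totalD E M) (k + 1) :=
  LinearEquiv.ofBijective
    ((inclForm E M k ∘ₗ (closedForms E M k).subtype).codRestrict _
      fun w => inclForm_mem_cocycles.2 w.2) <| by
    constructor
    · intro w w' h
      exact Subtype.ext (inclForm_injective k (congrArg Subtype.val h))
    · rintro ⟨x, hx⟩
      have h := hx.1
      rw [formGrading_natCast_add_one] at h
      obtain ⟨α, rfl⟩ := h
      exact ⟨⟨α, inclForm_mem_cocycles.1 hx⟩, rfl⟩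

/-- The de Rham cohomology is the Poisson-like cohomology of the exterior derivative. -/
def deRhamEquiv (h : IsCoboundaryOperator (formGrading E M) 1 (totalD E M)) (k : ℕ) :
    DeRhamCohomology E M k ≃ₗ[ℝ] PoissonLikeCohomology h (k + 1) :=
  Submodule.Quotient.equiv _ _ (closedFormsEquiv k) <| by
    ext y
    obtain ⟨w, rfl⟩ := (closedFormsEquiv k).surjective y
    rw [Submodule.mem_map_equiv, LinearEquiv.symm_apply_apply]
    exact inclForm_mem_coboundaries.symm

end PoissonDifferential

end FormCohomology
end

open FormCohomology in
theorem mainTheorem3 {E : Type*} [NormedAddCommGroup E] [NormedSpace ℝ E] [FiniteDimensional ℝ E]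
    {M : Type*} [TopologicalSpace M] [ChartedSpace E M] [IsManifold 𝓘(ℝ, E) ∞ M] :
    -- the forms with the bracket `[α, β] = (-1)^a d (α ∧ β)` are a Lie superalgebra
    IsLieSuperalgebra (formGrading E M) (superBracket E M) ∧
    -- `φ` is an even `p`-form
    (∀ p : ℕ, Even p → ∀ φ : Form E M p,
      superBracket E M (inclForm E M p φ) (inclForm E M p φ) =
        inclForm E M (p + p + 1) (Form.d E M (p + p) (φ.wedge φ)) ∧
      -- (1)
      (Form.d E M (p + p) (φ.wedge φ) = 0 →
        poissonD E M φ = totalD E M ∘ₗ totalWedge E M (inclForm E M p φ) ∧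
        poissonD E M φ = totalWedge E M (inclForm E M (p + 1) (Form.d E M p φ)) +
          totalWedge E M (inclForm E M p φ) ∘ₗ totalD E M ∧
        IsCoboundaryOperator (formGrading E M) (p + 1) (poissonD E M φ)) ∧
      -- (2)
      (Form.d E M p φ = 0 →
        poissonD E M φ = totalWedge E M (inclForm E M p φ) ∘ₗ totalD E M ∧
        IsCoboundaryOperator (formGrading E M) (p + 1) (poissonD E M φ))) ∧
    -- the case `φ = 1`
    (∃ h : IsCoboundaryOperator (formGrading E M) 1 (poissonD E M Form.one),
      (∀ i : ℤ, i ≤ 0 → Subsingleton (PoissonLikeCohomology h i)) ∧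
      ∀ k : ℕ, ∃ f : DeRhamCohomology E M k ≃ₗ[ℝ] PoissonLikeCohomology h (k + 1),
        ∀ w : closedForms E M k,
          ∃ hw : inclForm E M k w.1 ∈ cocycles (formGrading E M) (poissonD E M Form.one) (k + 1),
            f (Submodule.Quotient.mk w) = Submodule.Quotient.mk ⟨inclForm E M k w.1, hw⟩) := by
  -- This formula needs only that `p` is even, so it serves both (1) and (2).
  have leibniz {p : ℕ} (hp : Even p) (φ : Form E M p) :
      poissonD E M φ = totalWedge E M (inclForm E M (p + 1) (Form.d E M p φ)) +
        totalWedge E M (inclForm E M p φ) ∘ₗ totalD E M := by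
    refine LinearMap.ext fun y => ?_
    rw [poissonD_eq_of_even hp, ← totalD_incl]
    exact totalD_totalWedge_of_even hp φ y
  refine ⟨isLieSuperalgebra_forms, fun p hp φ => ⟨?_, fun hφ => ?_, fun hφ => ?_⟩, ?_⟩
  · rw [superBracket_incl, hp.neg_one_pow, one_smul]
  · exact ⟨poissonD_eq_of_even hp φ, leibniz hp φ, isCoboundaryOperator_poissonD hp φ hφ⟩
  · refine ⟨?_, isCoboundaryOperator_poissonD hp φ (Form.d_wedge_self_of_closed hp φ hφ)⟩
    rw [leibniz hp φ, hφ, map_zero, map_zero, zero_add]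
  -- Once the operator is `d`, the isomorphism acts on representatives by the inclusion of forms, so
  -- its description holds by `rfl`.
  · rw [poissonD_one]
    exact ⟨isCoboundaryOperator_totalD, fun i hi => subsingleton_poissonLikeCohomology _ hi,
      fun k => ⟨deRhamEquiv _ k, fun w => ⟨inclForm_mem_cocycles.2 w.2, rfl⟩⟩⟩
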